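/- **Temporal Stream Logic (TSL).** Fix an infinite set $\mathcal V$ of values. There are countably many names of input signals, output signals, $n$-ary functions and $n$-ary predicates for each $n\ge 0$. Function terms are $\tau ::= \mathsf s \mid \mathsf f(\tau_0,\dots,\tau_{n-1})$, with $\mathsf s$ an input or output signal and $\mathsf f$ an $n$-ary function; for every output signal $\mathsf s$ there is a predefined $0$-ary function $\mathrm{init}_{\mathsf s}$. Formulas are $$\varphi ::= \mathsf p(\tau_0,\dots,\tau_{n-1}) \mid [\mathsf s \leftarrow \tau] \mid \neg\varphi \mid \varphi\wedge\varphi \mid \bigcirc\varphi \mid \varphi\,\mathcal U\,\varphi ,$$ with $\mathsf p$ an $n$-ary predicate, $\mathsf s$ an output signal and $\tau$ a function term. Each formula $\varphi$ comes with a set $\mathcal N_\varphi$ of available names, which contains all names that occur in $\varphi$ and is otherwise arbitrary. A computation $\varsigma$ for $\varphi$ assigns, at every time $t\in\mathbb N$, to every output signal $\mathsf s\in\mathcal N_\varphi$ a function term $\varsigma(t)(\mathsf s)$ over the available names. An assignment $\langle\cdot\rangle$ gives every input name a signal $\mathbb N\to\mathcal V$, every $n$-ary function name (including the $\mathrm{init}_{\mathsf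 s}$) a function $\mathcal V^n\to\mathcal V$, and every $n$-ary predicate name a function $\mathcal V^n\to\{\text{true},\text{false}\}$. At time $0$ an output $\mathsf s$ has the value $\langle\mathrm{init}_{\mathsf s}\rangle$, and at time $t+1$ the value that the term $\varsigma(t)(\mathsf s)$ has at time $t$; inputs are read at the current time. Then $\varsigma,t\models\mathsf p(\tau_0,\dots,\tau_{n-1})$ iff $\langle\mathsf p\rangle$ is true of the values of the $\tau_i$ at time $t$; $\varsigma,t\models[\mathsf s\leftarrow\tau]$ iff $\varsigma(t)(\mathsf s)$ is syntactically equal to $\tau$; the remaining operators have their usual LTL meaning; and $\varsigma\models\varphi$ means $\varsigma,0\models\varphi$. The formula $\varphi$ is *realizable* if there is a computation $\varsigma$ such that $\varsigma\models\varphi$ for all assignments $\langle\cdot\rangle$. **Theorem.** The realizability problem of TSL is undecidable: there is no algorithm that, given a TSL formula $\varphi$ (through a standard Gödel numbering), decides whether $\varphi$ is realizable. It remains undecidable for formulas in which no input signal occurs. Consequently, satisfiability of TSL is undecidable as well; this holds both when a formula is called satisfiable if $\varsigma\models\varphi$ for some computation $\varsigma$ and some assignment, and when it is called satisfiable if there are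 a computation $\varsigma$ and input signals such that $\varsigma\models\varphi$ for all initial values, functions and predicates. -/

import Mathlib

namespace TSL

/-! ### Syntax

Input signals, output signals, functions and predicates are named by natural numbers; a function or
predicate name is the pair of its arity and its index, so that there are countably many names of
every kind and arity. -/

/-- Function terms: signals, or functions applied to function terms. The `0`-ary functions
`init s`, one for each output signal `s`, are predefined. -/
inductive FTerm : Type
  | input (i : ℕ) : FTerm
  | output (s : ℕ) : FTerm
  | init (s : ℕ) : FTerm
  | app (n f : ℕ) (args : Fin n → FTerm) : FTerm

/-- TSL formulas: predicate terms, update terms `s ↢ τ`, negation, conjunction, next and until. -/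
inductive Formula : Type
  | pred (n p : ℕ) (args : Fin n → FTerm) : Formula
  | update (s : ℕ) (τ : FTerm) : Formula
  | neg (φ : Formula) : Formula
  | and (φ ψ : Formula) : Formula
  | next (φ : Formula) : Formula
  | untl (φ ψ : Formula) : Formula

/-- The sets of available names; elements of `funcs` and `preds` are pairs (arity, index). -/
structure Vocabulary where
  inputs : Set ℕ
  outputs : Set ℕ
  funcs : Set (ℕ × ℕ)
  preds : Set (ℕ × ℕ)

/-- All names in the term belong to the vocabulary. -/
def FTerm.Over (N : Vocabulary) : FTerm → Prop
  | .input i => i ∈ N.inputs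
  | .output s => s ∈ N.outputs
  | .init s => s ∈ N.outputs
  | .app n f args => (n, f) ∈ N.funcs ∧ ∀ j, (args j).Over N

/-- All names in the formula belong to the vocabulary. -/
def Formula.Over (N : Vocabulary) : Formula → Prop
  | .pred n p args => (n, p) ∈ N.preds ∧ ∀ j, (args j).Over N
  | .update s τ => s ∈ N.outputs ∧ τ.Over N
  | .neg φ => φ.Over N
  | .and φ ψ => φ.Over N ∧ ψ.Over N
  | .next φ => φ.Over N
  | .untl φ ψ => φ.Over N ∧ ψ.Over N

/-- No input signal occurs in the formula. -/
def Formula.InputFree (φ : Formula) : Prop :=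
  φ.Over ⟨∅, Set.univ, Set.univ, Set.univ⟩

/-! ### Semantics -/

/-- An assignment of input signals, initial values, pure functions and predicates over the set `𝒱`
of values to the names. -/
structure Assignment (𝒱 : Type*) where
  input : ℕ → ℕ → 𝒱
  init : ℕ → 𝒱
  func : (n f : ℕ) → (Fin n → 𝒱) → 𝒱
  pred : (n p : ℕ) → (Fin n → 𝒱) → Bool

/-- A computation: at every point in time, every output signal is assigned a function term (the
terms assigned to names that are not available outputs are irrelevant). -/
abbrev Computation : Type := ℕ → ℕ → FTerm

/-- The computation is a sequence of computation steps over the vocabulary. -/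
def Computation.Over (N : Vocabulary) (ς : Computation) : Prop :=
  ∀ t, ∀ s ∈ N.outputs, (ς t s).Over N

/-- The value of a term at time `t`, when the output signals currently have the values `out`. -/
def FTerm.eval {𝒱 : Type*} (a : Assignment 𝒱) (t : ℕ) (out : ℕ → 𝒱) : FTerm → 𝒱
  | .input i => a.input i t
  | .output s => out s
  | .init s => a.init s
  | .app n f args => a.func n f fun j => (args j).eval a t out

/-- The value of output signal `s` at time `t`: initially that of `init s`, and at time `t + 1` the
value which the term assigned to `s` by the computation at time `t` has at time `t`. -/
def outVal {𝒱 : Type*} (a : Assignment 𝒱) (ς : Computation) : ℕ → ℕ → 𝒱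
  | 0, s => a.init s
  | t + 1, s => (ς t s).eval a t (outVal a ς t)

/-- The value of a term at time `t` under a computation. -/
def value {𝒱 : Type*} (a : Assignment 𝒱) (ς : Computation) (t : ℕ) (τ : FTerm) : 𝒱 :=
  τ.eval a t (outVal a ς t)

/-- Satisfaction `ς, t ⊨ φ` with respect to the assignment `a`. Updates are compared
syntactically. -/
def Sat {𝒱 : Type*} (a : Assignment 𝒱) (ς : Computation) : ℕ → Formula → Prop
  | t, .pred n p args => a.pred n p (fun j => value a ς t (args j)) = true
  | t, .update s τ => ς t s = τ
  | t, .neg φ => ¬ Sat a ς t φ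
  | t, .and φ ψ => Sat a ς t φ ∧ Sat a ς t ψ
  | t, .next φ => Sat a ς (t + 1) φ
  | t, .untl φ ψ =>
      ∃ t'' ≥ t, (∀ t', t ≤ t' → t' < t'' → Sat a ς t' φ) ∧ Sat a ς t'' ψ

/-- Realizability: some computation satisfies the formula under all assignments. -/
def Realizable (𝒱 : Type*) (N : Vocabulary) (φ : Formula) : Prop :=
  ∃ ς : Computation, ς.Over N ∧ ∀ a : Assignment 𝒱, Sat a ς 0 φ

/-- Satisfiability: some computation satisfies the formula under some assignment. -/
def Satisfiable (𝒱 : Type*) (N : Vocabulary) (φ : Formula) : Prop :=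
  ∃ ς : Computation, ς.Over N ∧ ∃ a : Assignment 𝒱, Sat a ς 0 φ

/-- Satisfiability with uninterpreted functions and predicates: for some computation and some input
signals, the formula is satisfied under all initial values, functions and predicates. -/
def UniformlySatisfiable (𝒱 : Type*) (N : Vocabulary) (φ : Formula) : Prop :=
  ∃ ς : Computation, ς.Over N ∧ ∃ inp : ℕ → ℕ → 𝒱,
    ∀ a : Assignment 𝒱, a.input = inp → Sat a ς 0 φ

/-! ### Decision problems on formulas -/

/-- Gödel numbers of terms. -/
def FTerm.code : FTerm → ℕ
  | .input i => Nat.pair 0 i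
  | .output s => Nat.pair 1 s
  | .init s => Nat.pair 2 s
  | .app n f args =>
      Nat.pair 3 (Nat.pair n (Nat.pair f (Encodable.encode (List.ofFn fun j => (args j).code))))

/-- Gödel numbers of formulas. -/
def Formula.code : Formula → ℕ
  | .pred n p args =>
      Nat.pair 0 (Nat.pair n (Nat.pair p (Encodable.encode (List.ofFn fun j => (args j).code))))
  | .update s τ => Nat.pair 1 (Nat.pair s τ.code)
  | .neg φ => Nat.pair 2 φ.code
  | .and φ ψ => Nat.pair 3 (Nat.pair φ.code ψ.code)
  | .next φ => Nat.pair 4 φ.code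
  | .untl φ ψ => Nat.pair 5 (Nat.pair φ.code ψ.code)

theorem FTerm.code_injective : Function.Injective FTerm.code := by
  intro τ
  induction τ with
  | app n f args ih =>
    intro τ' h
    cases τ' with
    | app n' f' args' =>
      simp only [FTerm.code, Nat.pair_eq_pair, true_and] at h
      obtain ⟨rfl, rfl, h⟩ := h
      have h' := List.ofFn_injective (Encodable.encode_injective h)
      congr 1
      funext j
      exact ih j (congrFun h' j)
    | _ => simp [FTerm.code, Nat.pair_eq_pair] at h
  | _ =>
    intro τ' h
    cases τ' <;> simp_all [FTerm.code, Nat.pair_eq_pair]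

theorem Formula.code_injective : Function.Injective Formula.code := by
  intro φ
  induction φ with
  | pred n p args =>
    intro φ' h
    cases φ' with
    | pred n' p' args' =>
      simp only [Formula.code, Nat.pair_eq_pair, true_and] at h
      obtain ⟨rfl, rfl, h⟩ := h
      have h' := List.ofFn_injective (Encodable.encode_injective h)
      congr 1
      funext j
      exact FTerm.code_injective (congrFun h' j)
    | _ => simp [Formula.code, Nat.pair_eq_pair] at h
  | update s τ =>
    intro φ' h
    cases φ' <;> simp_all [Formula.code, Nat.pair_eq_pair]
    exact FTerm.code_injective h.2
  | neg φ ih =>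
    intro φ' h
    cases φ' <;> simp only [Formula.code, Nat.pair_eq_pair] at h <;> simp at h
    rw [ih h]
  | next φ ih =>
    intro φ' h
    cases φ' <;> simp only [Formula.code, Nat.pair_eq_pair] at h <;> simp at h
    rw [ih h]
  | and φ ψ ih₁ ih₂ =>
    intro φ' h
    cases φ' <;> simp only [Formula.code, Nat.pair_eq_pair] at h <;> simp at h
    rw [ih₁ h.1, ih₂ h.2]
  | untl φ ψ ih₁ ih₂ =>
    intro φ' h
    cases φ' <;> simp only [Formula.code, Nat.pair_eq_pair] at h <;> simp at h
    rw [ih₁ h.1, ih₂ h.2]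

/-- The property `P` is algorithmically decidable for the formulas in the class `C`: some total
computable function, given the Gödel number of a formula in `C`, tells whether `P` holds. -/
def DecidableOn (C P : Formula → Prop) : Prop :=
  ∃ d : ℕ → Bool, Computable d ∧ ∀ φ, C φ → (d φ.code = true ↔ P φ)

/-- The property `P` of formulas is undecidable. -/
def Undecidable (P : Formula → Prop) : Prop :=
  ¬ DecidableOn (fun _ => True) P

end TSL

/-! The halting problem reduces to TSL by letting time play the role of a universal quantifier over
natural numbers. A partial recursive function is described by Horn clauses over zero and successor,
with predicates for addition, squares, pairing and the graphs of its subprograms. The clauses are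
sound in the intended model (`arithClauses_sound`, `codeClauses_sound`), and every relation family
satisfying them contains the graph (`graph_of_clauses`).

Eight outputs serve as clause variables and a ninth as a bound. Updated like an odometer, they run
through all tuples of numerals (`odo_visits`), so "always the clauses" yields every numeral instance
of the clauses.

`haltFormula` says: if the clauses always hold, then at some time output 0 is a result of `c` on
`n`. If `c` halts on `n`, the fixed odometer computation realizes it. If some computation satisfies
it uniformly, the standard assignment, available because the value set is infinite, makes the
clauses true at all times, so a result exists. Uniform satisfiability lies between realizability and
halting, so the same reduction covers it.

For plain satisfiability the formula must itself force the odometer. `divergeFormula` makes the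
updates depend on a comparison predicate, which `eqAxioms` force to be equality on the numbers
already visited; it then requires that no result ever appears, which reduces from divergence. -/

namespace TSL

/-! ### Horn clauses for partial recursive functions -/

open Nat.Partrec (Code)

/-- Argument of an atom: zero, a variable, or the successor of a variable. -/
inductive Arg : Type
  | zero : Arg
  | var (i : Fin 8) : Arg
  | succ (i : Fin 8) : Arg

/-- The natural number denoted by an argument. -/
def Arg.val (b : Fin 8 → ℕ) : Arg → ℕ
  | .zero => 0
  | .var i => b i
  | .succ i => b i + 1

/-- An atom: a ternary relation symbol with its arguments. -/
structure Atom where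
  rel : ℕ
  fst : Arg
  snd : Arg
  thd : Arg

/-- Truth of an atom under an interpretation of the relation symbols over the natural numbers. -/
def Atom.Holds (I : ℕ → ℕ → ℕ → ℕ → Prop) (b : Fin 8 → ℕ) (A : Atom) : Prop :=
  I A.rel (A.fst.val b) (A.snd.val b) (A.thd.val b)

/-- A Horn clause. -/
structure Clause where
  body : List Atom
  head : Atom

/-- Truth of a Horn clause. -/
def Clause.Holds (I : ℕ → ℕ → ℕ → ℕ → Prop) (b : Fin 8 → ℕ) (C : Clause) : Prop :=
  C.body.foldr (fun A p => A.Holds I b → p) (C.head.Holds I b)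

/-- The relation symbol for the graph of the partial function with code `c`. -/
def graphRel (c : Code) : ℕ := Encodable.encode c + 4

/-- The intended interpretation of the relation symbols. -/
def stdRel : ℕ → ℕ → ℕ → ℕ → Prop
  | 0, x, y, _ => x = y
  | 1, x, y, _ => y = x * x
  | 2, x, y, z => z = x + y
  | 3, x, y, z => z = Nat.pair x y
  | p + 4, x, y, _ => y ∈ (Denumerable.ofNat Code p).eval x

section
local notation "sq(" x "," y ")" => Atom.mk 1 x y Arg.zero
local notation "add(" x "," y "," z ")" => Atom.mk 2 x y z
local notation "pair(" x "," y "," z ")" => Atom.mk 3 x y z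
local notation "gr(" c "," x "," y ")" => Atom.mk (graphRel c) x y Arg.zero
local notation "o" => Arg.zero
local notation "v" => Arg.var
local notation "s" => Arg.succ

/-- Clauses for addition, squares and the pairing function. -/
def arithClauses : List Clause :=
  [⟨[], add(v 0, o, v 0)⟩,
   ⟨[add(v 0, v 1, v 2)], add(v 0, s 1, s 2)⟩,
   ⟨[], sq(o, o)⟩,
   ⟨[sq(v 0, v 1), add(v 1, v 0, v 2), add(v 2, v 0, v 3)], sq(s 0, s 3)⟩,
   ⟨[add(v 0, s 1, v 2), sq(v 2, v 3), add(v 3, v 0, v 4)], pair(v 0, v 2, v 4)⟩,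
   ⟨[add(v 1, v 2, v 0), sq(v 0, v 3), add(v 3, v 0, v 4), add(v 4, v 1, v 5)],
      pair(v 0, v 1, v 5)⟩]

/-- Clauses for the graph of the partial function with the given code. -/
def codeClauses : Code → List Clause
  | .zero => [⟨[], gr(.zero, v 0, o)⟩]
  | .succ => [⟨[], gr(.succ, v 0, s 0)⟩]
  | .left => [⟨[pair(v 0, v 1, v 2)], gr(.left, v 2, v 0)⟩]
  | .right => [⟨[pair(v 0, v 1, v 2)], gr(.right, v 2, v 1)⟩]
  | .pair c d =>
      ⟨[gr(c, v 0, v 1), gr(d, v 0, v 2), pair(v 1, v 2, v 3)], gr(.pair c d, v 0, v 3)⟩ ::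
        (codeClauses c ++ codeClauses d)
  | .comp c d =>
      ⟨[gr(d, v 0, v 1), gr(c, v 1, v 2)], gr(.comp c d, v 0, v 2)⟩ ::
        (codeClauses c ++ codeClauses d)
  | .prec c d =>
      ⟨[pair(v 0, o, v 1), gr(c, v 0, v 2)], gr(.prec c d, v 1, v 2)⟩ ::
      -- This clause uses all eight variables and so fixes the number of odometer digits.
      ⟨[pair(v 0, v 1, v 2), gr(.prec c d, v 2, v 3), pair(v 1, v 3, v 4), pair(v 0, v 4, v 5),
        gr(d, v 5, v 6), pair(v 0, s 1, v 7)], gr(.prec c d, v 7, v 6)⟩ ::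
        (codeClauses c ++ codeClauses d)
  | .rfind' c =>
      ⟨[pair(v 0, v 1, v 2), gr(c, v 2, o)], gr(.rfind' c, v 2, v 1)⟩ ::
      ⟨[pair(v 0, v 1, v 2), gr(c, v 2, s 3), pair(v 0, s 1, v 4), gr(.rfind' c, v 4, v 5)],
        gr(.rfind' c, v 2, v 5)⟩ ::
        codeClauses c
end

/-! ### Soundness of the clauses in the intended interpretation -/

theorem stdRel_graphRel (c : Code) (x y z : ℕ) : stdRel (graphRel c) x y z ↔ y ∈ c.eval x := by
  simp [stdRel, graphRel]

theorem arithClauses_sound : ∀ C ∈ arithClauses, ∀ b, C.Holds stdRel b := by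
  intro C hC b
  simp only [arithClauses, List.mem_cons, List.not_mem_nil, or_false] at hC
  rcases hC with rfl | rfl | rfl | rfl | rfl | rfl <;>
    simp only [Clause.Holds, Atom.Holds, Arg.val, stdRel, List.foldr] <;> intros
  · rfl
  · omega
  · rename_i h1 h2 h3
    rw [h3, h2, h1]
    ring
  · rename_i h1 h2 h3
    rw [Nat.pair, if_pos (by omega), h3, h2]
  · rename_i h1 h2 h3 h4
    rw [Nat.pair, if_neg (by omega), h4, h3, h2]

/-- Unfolds unbounded search by one step. This replaces the bounded quantifier "no earlier zero" by
a recursion that Horn clauses can express. -/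
theorem mem_eval_rfind' {c : Code} {a m r : ℕ} :
    r ∈ (Code.rfind' c).eval (Nat.pair a m) ↔
      0 ∈ c.eval (Nat.pair a m) ∧ r = m ∨
      (∃ i, i + 1 ∈ c.eval (Nat.pair a m)) ∧ r ∈ (Code.rfind' c).eval (Nat.pair a (m + 1)) := by
  simp only [Code.eval, Nat.unpaired, Nat.unpair_pair, Part.mem_map_iff]
  constructor
  · rintro ⟨n, hn, rfl⟩
    obtain ⟨h0, hlt⟩ := Nat.mem_rfind.1 hn
    cases n with
    | zero =>
      left
      simpa using h0
    | succ n =>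
      right
      constructor
      · obtain ⟨i, hi, hi0⟩ := (Part.mem_map_iff _).1 (hlt (Nat.succ_pos n))
        obtain ⟨j, rfl⟩ := Nat.exists_eq_succ_of_ne_zero (of_decide_eq_false hi0)
        exact ⟨j, by simpa using hi⟩
      · refine ⟨n, Nat.mem_rfind.2 ⟨?_, fun {k} hk => ?_⟩, by omega⟩
        · rwa [show n + (m + 1) = n + 1 + m by omega]
        · have := hlt (Nat.succ_lt_succ hk)
          rwa [show k + (m + 1) = k + 1 + m by omega]
  · rintro (⟨h0, rfl⟩ | ⟨⟨i, hi⟩, n, hn, rfl⟩)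
    · exact ⟨0, Nat.mem_rfind.2 ⟨by simpa using h0,
        fun {k} hk => absurd hk (Nat.not_lt_zero k)⟩, by simp⟩
    · obtain ⟨h0, hlt⟩ := Nat.mem_rfind.1 hn
      refine ⟨n + 1, Nat.mem_rfind.2 ⟨?_, fun {k} hk => ?_⟩, by omega⟩
      · rwa [show n + 1 + m = n + (m + 1) by omega]
      · cases k with
        | zero =>
          exact (Part.mem_map_iff _).2 ⟨i + 1, by simpa using hi, by simp⟩
        | succ k =>
          have := hlt (Nat.lt_of_succ_lt_succ hk)
          rwa [show k + 1 + m = k + (m + 1) by omega]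

theorem codeClauses_sound (c : Code) : ∀ C ∈ codeClauses c, ∀ b, C.Holds stdRel b := by
  induction c with
  | zero =>
    simp [codeClauses, Clause.Holds, Atom.Holds, Arg.val, stdRel_graphRel, Code.eval, pure,
      PFun.pure]
  | succ => simp [codeClauses, Clause.Holds, Atom.Holds, Arg.val, stdRel_graphRel, Code.eval]
  | left =>
    simp only [codeClauses, List.mem_singleton, forall_eq, Clause.Holds, Atom.Holds, Arg.val,
      stdRel_graphRel, List.foldr]
    intro b h
    simp [show b 2 = _ from h, Code.eval]
  | right =>
    simp only [codeClauses, List.mem_singleton, forall_eq, Clause.Holds, Atom.Holds, Arg.val,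
      stdRel_graphRel, List.foldr]
    intro b h
    simp [show b 2 = _ from h, Code.eval]
  | pair c d ihc ihd =>
    simp only [codeClauses, List.mem_cons, List.mem_append]
    rintro C (rfl | h | h)
    · simp only [Clause.Holds, Atom.Holds, Arg.val, stdRel_graphRel, List.foldr]
      intro b h1 h2 h3
      simp only [show b 3 = _ from h3, Code.eval, Seq.seq]
      exact Part.mem_bind ((Part.mem_map_iff _).2 ⟨_, h1, rfl⟩)
        ((Part.mem_map_iff _).2 ⟨_, h2, rfl⟩)
    · exact ihc C h
    · exact ihd C h
  | comp c d ihc ihd =>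
    simp only [codeClauses, List.mem_cons, List.mem_append]
    rintro C (rfl | h | h)
    · simp only [Clause.Holds, Atom.Holds, Arg.val, stdRel_graphRel, List.foldr]
      intro b h1 h2
      exact Part.mem_bind h1 h2
    · exact ihc C h
    · exact ihd C h
  | prec c d ihc ihd =>
    simp only [codeClauses, List.mem_cons, List.mem_append]
    rintro C (rfl | rfl | h | h)
    · simp only [Clause.Holds, Atom.Holds, Arg.val, stdRel_graphRel, List.foldr]
      intro b h1 h2
      rw [show b 1 = _ from h1, Code.eval_prec_zero]
      exact h2
    · simp only [Clause.Holds, Atom.Holds, Arg.val, stdRel_graphRel, List.foldr]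
      intro b h1 h2 h3 h4 h5 h6
      rw [show b 7 = _ from h6, ← Nat.succ_eq_add_one, Code.eval_prec_succ]
      simp only [stdRel] at h1 h3 h4
      rw [h1] at h2
      rw [h4, h3] at h5
      exact Part.mem_bind h2 h5
    · exact ihc C h
    · exact ihd C h
  | rfind' c ih =>
    simp only [codeClauses, List.mem_cons]
    rintro C (rfl | rfl | h)
    · simp only [Clause.Holds, Atom.Holds, Arg.val, stdRel_graphRel, List.foldr]
      intro b h1 h2
      simp only [stdRel] at h1
      rw [h1] at h2 ⊢
      exact mem_eval_rfind'.2 (.inl ⟨h2, rfl⟩)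
    · simp only [Clause.Holds, Atom.Holds, Arg.val, stdRel_graphRel, List.foldr]
      intro b h1 h2 h3 h4
      simp only [stdRel] at h1 h3
      rw [h1] at h2 ⊢
      rw [h3] at h4
      exact mem_eval_rfind'.2 (.inr ⟨⟨_, h2⟩, h4⟩)
    · exact ih C h

/-! ### Completeness: the graphs lie in every model of the clauses -/

section Complete

variable {I : ℕ → ℕ → ℕ → ℕ → Prop}

theorem add_of_arithClauses (h : ∀ C ∈ arithClauses, ∀ b, C.Holds I b) (x y : ℕ) :
    I 2 x y (x + y) := by
  simp only [arithClauses, List.forall_mem_cons] at h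
  induction y with
  | zero => exact h.1 ![x, 0, 0, 0, 0, 0, 0, 0]
  | succ y ih => exact h.2.1 ![x, y, x + y, 0, 0, 0, 0, 0] ih

theorem sq_of_arithClauses (h : ∀ C ∈ arithClauses, ∀ b, C.Holds I b) (x : ℕ) :
    I 1 x (x * x) 0 := by
  have hadd := add_of_arithClauses h
  simp only [arithClauses, List.forall_mem_cons] at h
  induction x with
  | zero => exact h.2.2.1 ![0, 0, 0, 0, 0, 0, 0, 0]
  | succ x ih =>
    rw [show (x + 1) * (x + 1) = x * x + x + x + 1 by ring]
    exact h.2.2.2.1 ![x, x * x, x * x + x, x * x + x + x, 0, 0, 0, 0] ih (hadd _ _) (hadd _ _)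

theorem pair_of_arithClauses (h : ∀ C ∈ arithClauses, ∀ b, C.Holds I b) (x y : ℕ) :
    I 3 x y (Nat.pair x y) := by
  have hadd := add_of_arithClauses h
  have hsq := sq_of_arithClauses h
  simp only [arithClauses, List.forall_mem_cons] at h
  unfold Nat.pair
  split_ifs with hxy
  · obtain ⟨d, rfl⟩ := Nat.exists_eq_add_of_lt hxy
    exact h.2.2.2.2.1 ![x, d, x + d + 1, (x + d + 1) * (x + d + 1),
      (x + d + 1) * (x + d + 1) + x, 0, 0, 0] (hadd x (d + 1)) (hsq _) (hadd _ _)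
  · obtain ⟨d, rfl⟩ := Nat.exists_eq_add_of_le (not_lt.1 hxy)
    exact h.2.2.2.2.2.1 ![y + d, y, d, (y + d) * (y + d), (y + d) * (y + d) + (y + d),
      (y + d) * (y + d) + (y + d) + y, 0, 0] (hadd y d) (hsq _) (hadd _ _) (hadd _ _)

theorem graph_of_clauses (h : ∀ C ∈ arithClauses, ∀ b, C.Holds I b) (c : Code)
    (hc : ∀ C ∈ codeClauses c, ∀ b, C.Holds I b) {x y : ℕ} (hy : y ∈ c.eval x) :
    I (graphRel c) x y 0 := by
  have hp := pair_of_arithClauses h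
  induction c generalizing x y with
  | zero =>
    simp only [codeClauses, List.forall_mem_cons] at hc
    obtain rfl : y = 0 := by simpa [Code.eval, pure, PFun.pure] using hy
    exact hc.1 ![x, 0, 0, 0, 0, 0, 0, 0]
  | succ =>
    simp only [codeClauses, List.forall_mem_cons] at hc
    obtain rfl : y = x + 1 := by simpa [Code.eval] using hy
    exact hc.1 ![x, 0, 0, 0, 0, 0, 0, 0]
  | left =>
    simp only [codeClauses, List.forall_mem_cons] at hc
    obtain rfl : y = x.unpair.1 := by simpa [Code.eval] using hy
    have := hp x.unpair.1 x.unpair.2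
    rw [Nat.pair_unpair] at this
    exact hc.1 ![x.unpair.1, x.unpair.2, x, 0, 0, 0, 0, 0] this
  | right =>
    simp only [codeClauses, List.forall_mem_cons] at hc
    obtain rfl : y = x.unpair.2 := by simpa [Code.eval] using hy
    have := hp x.unpair.1 x.unpair.2
    rw [Nat.pair_unpair] at this
    exact hc.1 ![x.unpair.1, x.unpair.2, x, 0, 0, 0, 0, 0] this
  | pair c d ihc ihd =>
    simp only [codeClauses, List.forall_mem_cons, List.forall_mem_append] at hc
    simp only [Code.eval, Seq.seq] at hy
    obtain ⟨u, hu, w, hw, rfl⟩ : ∃ u ∈ c.eval x, ∃ w ∈ d.eval x, Nat.pair u w = y := by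
      simpa using hy
    exact hc.1 ![x, u, w, Nat.pair u w, 0, 0, 0, 0] (ihc hc.2.1 hu) (ihd hc.2.2 hw) (hp u w)
  | comp c d ihc ihd =>
    simp only [codeClauses, List.forall_mem_cons, List.forall_mem_append] at hc
    obtain ⟨u, hu, hw⟩ := Part.mem_bind_iff.1 hy
    exact hc.1 ![x, u, y, 0, 0, 0, 0, 0] (ihd hc.2.2 hu) (ihc hc.2.1 hw)
  | prec c d ihc ihd =>
    simp only [codeClauses, List.forall_mem_cons, List.forall_mem_append] at hc
    obtain ⟨a, n, rfl⟩ : ∃ a n, x = Nat.pair a n := ⟨_, _, (Nat.pair_unpair x).symm⟩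
    induction n generalizing y with
    | zero =>
      rw [Code.eval_prec_zero] at hy
      exact hc.1 ![a, Nat.pair a 0, y, 0, 0, 0, 0, 0] (hp _ _) (ihc hc.2.2.1 hy)
    | succ n ih =>
      rw [← Nat.succ_eq_add_one, Code.eval_prec_succ] at hy
      obtain ⟨i, hi, hy⟩ := Part.mem_bind_iff.1 hy
      exact hc.2.1 ![a, n, Nat.pair a n, i, Nat.pair n i, Nat.pair a (Nat.pair n i), y,
        Nat.pair a (n + 1)] (hp _ _) (ih hi) (hp _ _) (hp _ _)
        (ihd hc.2.2.2 hy) (hp _ _)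
  | rfind' c ih =>
    simp only [codeClauses, List.forall_mem_cons] at hc
    obtain ⟨a, m, rfl⟩ : ∃ a n, x = Nat.pair a n := ⟨_, _, (Nat.pair_unpair x).symm⟩
    have hle : m ≤ y := by
      simp only [Code.eval, Nat.unpaired, Nat.unpair_pair, Part.mem_map_iff] at hy
      obtain ⟨n, -, rfl⟩ := hy
      omega
    -- The inner induction is on the distance from the start of the search to its result.
    obtain ⟨k, hk⟩ : ∃ k, k = y - m := ⟨_, rfl⟩
    induction k generalizing m with
    | zero =>
      rcases mem_eval_rfind'.1 hy with ⟨h0, rfl⟩ | ⟨-, h1⟩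
      · exact hc.1 ![a, y, Nat.pair a y, 0, 0, 0, 0, 0] (hp _ _) (ih hc.2.2 h0)
      · simp only [Code.eval, Nat.unpaired, Nat.unpair_pair, Part.mem_map_iff] at h1
        obtain ⟨n, -, hn⟩ := h1
        omega
    | succ k ihk =>
      rcases mem_eval_rfind'.1 hy with ⟨h0, rfl⟩ | ⟨⟨i, hi⟩, h1⟩
      · omega
      · exact hc.2.1 ![a, m, Nat.pair a m, i, Nat.pair a (m + 1), y, 0, 0] (hp _ _) (ih hc.2.2 hi)
          (hp _ _) (ihk (m + 1) h1 (by omega) (by omega))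

end Complete

/-! ### An enumeration of all tuples -/

/-- One step of an odometer with digits `0, …, k - 1`, each of which runs from `0` to the number at
position `k`, which is increased when all digits overflow. -/
def odoStep (k : ℕ) (X : ℕ → ℕ) (s : ℕ) : ℕ :=
  if ∀ j < s, X j = X k then (if s < k ∧ X s = X k then 0 else X s + 1) else X s

/-- The states of the odometer, started at zero. -/
def odo (k : ℕ) (t : ℕ) : ℕ → ℕ := (odoStep k)^[t] fun _ => 0

theorem odo_succ (k t : ℕ) : odo k (t + 1) = odoStep k (odo k t) :=
  Function.iterate_succ_apply' _ _ _

theorem odo_bound_mono (k : ℕ) : Monotone fun t => odo k t k := by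
  refine monotone_nat_of_le_succ fun t => ?_
  simp only [odo_succ, odoStep]
  split_ifs <;> omega

/-- The positions from `i` on, including the bound, end unchanged, so the induction can treat the
lower digits as a smaller odometer and run it repeatedly. -/
theorem odoStep_reaches (k i : ℕ) (hi : i ≤ k) (X : ℕ → ℕ) (hX : ∀ j < i, X j = 0) (b : ℕ → ℕ)
    (hb : ∀ j < i, b j ≤ X k) : ∃ n, (odoStep k)^[n] X = fun s => if s < i then b s else X s := by
  induction i generalizing X b with
  | zero => exact ⟨0, by simp⟩
  | succ i ih =>
    have key : ∀ w ≤ X k, ∃ n, (odoStep k)^[n] X =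
        fun s => if s < i then 0 else if s = i then w else X s := by
      intro w hw
      induction w with
      | zero =>
        refine ⟨0, funext fun s => ?_⟩
        have := hX s
        simp only [Function.iterate_zero, id]
        split_ifs <;> first | rfl | exact this (by omega)
      | succ w ihw =>
        obtain ⟨n, hn⟩ := ihw (by omega)
        -- Fill the lower digits up to the bound; one further step then clears them and carries into
        -- digit `i`.
        obtain ⟨m, hm⟩ := ih (by omega) ((odoStep k)^[n] X) (by rw [hn]; intro j hj; simp [hj])
          (fun _ => X k) (by
            rw [hn]; intro j hj
            simp [show ¬ k < i by omega, show k ≠ i by omega])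
        refine ⟨(m + n) + 1, funext fun s => ?_⟩
        rw [Function.iterate_succ_apply', Function.iterate_add_apply, hm, hn]
        simp only [odoStep, show ¬ k < i by omega, show k ≠ i by omega, if_false]
        rcases lt_trichotomy s i with hs | rfl | hs
        · have : ∀ j < s, j < i := fun j hj => by omega
          simp +contextual [hs, this, show s < k by omega]
        · simp +contextual [show w ≠ X k by omega]
        · have : ¬ ∀ j < s, (if j < i then X k else if j < i then 0 else if j = i then w else X j)
              = X k := by
            intro h
            have := h i hs
            simp at this
            omega
          rw [if_neg this]
          simp [show ¬ s < i by omega, show s ≠ i by omega]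
    obtain ⟨n, hn⟩ := key (b i) (hb i (by omega))
    obtain ⟨m, hm⟩ := ih (by omega) ((odoStep k)^[n] X) (by rw [hn]; intro j hj; simp [hj]) b (by
      rw [hn]; intro j hj
      simpa [show ¬ k < i by omega, show k ≠ i by omega] using hb j (by omega))
    refine ⟨m + n, funext fun s => ?_⟩
    rw [Function.iterate_add_apply, hm, hn]
    rcases lt_trichotomy s i with hs | rfl | hs
    · simp [hs, show s < i + 1 by omega]
    · simp
    · simp [show ¬ s < i by omega, show s ≠ i by omega, show ¬ s < i + 1 by omega]

theorem odo_visits_zero (k y : ℕ) : ∃ t, (∀ j < k, odo k t j = 0) ∧ odo k t k = y := by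
  induction y with
  | zero => exact ⟨0, by simp [odo]⟩
  | succ y ih =>
    obtain ⟨t, ht, hy⟩ := ih
    -- Once all digits equal `y`, the next step overflows: the digits return to zero and the bound
    -- becomes `y + 1`.
    obtain ⟨n, hn⟩ := odoStep_reaches k k le_rfl (odo k t) ht (fun _ => y) (by simp [hy])
    refine ⟨n + t + 1, ?_⟩
    have : odo k (n + t) = fun s => if s < k then y else odo k t s := by
      rw [← hn, odo, Function.iterate_add_apply]; rfl
    rw [odo_succ, this]
    constructor
    · intro j hj
      have : ∀ i < j, i < k := fun i hi => by omega
      simp +contextual [odoStep, hj, hy, this]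
    · simp +contextual [odoStep, hy]

/-- The odometer visits all tuples, together with every bound. -/
theorem odo_visits (k y : ℕ) (b : ℕ → ℕ) (hb : ∀ j < k, b j ≤ y) :
    ∃ t, (∀ j < k, odo k t j = b j) ∧ odo k t k = y := by
  obtain ⟨t, ht, hy⟩ := odo_visits_zero k y
  obtain ⟨n, hn⟩ := odoStep_reaches k k le_rfl (odo k t) ht b (by simpa [hy] using hb)
  refine ⟨n + t, ?_⟩
  have : odo k (n + t) = fun s => if s < k then b s else odo k t s := by
    rw [← hn, odo, Function.iterate_add_apply]; rfl
  rw [this]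
  constructor
  · intro j hj
    simp [hj]
  · simp [hy]

/-! ### Derived terms and formulas -/

/-- The constant zero. -/
def FTerm.zero : FTerm := .app 0 0 ![]

/-- The successor of a term. -/
def FTerm.succ (τ : FTerm) : FTerm := .app 1 0 ![τ]

/-- The numeral of a natural number. -/
def FTerm.numeral : ℕ → FTerm
  | 0 => .zero
  | n + 1 => (numeral n).succ

/-- The ternary predicate term with the given name. -/
def Formula.rel (p : ℕ) (σ τ υ : FTerm) : Formula := .pred 3 p ![σ, τ, υ]

def Formula.imp (φ ψ : Formula) : Formula := .neg (.and φ (.neg ψ))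

/-- Eventually. -/
def Formula.ev (φ : Formula) : Formula := .untl (φ.imp φ) φ

/-- Always. -/
def Formula.alw (φ : Formula) : Formula := φ.neg.ev.neg

/-- The conjunction of a list of formulas. -/
def Formula.conj : List Formula → Formula
  | [] => (Formula.update 0 .zero).imp (.update 0 .zero)
  | φ :: l => φ.and (conj l)

def Arg.toTerm : Arg → FTerm
  | .zero => .zero
  | .var i => .output i
  | .succ i => .succ (.output i)

def Atom.toFormula (A : Atom) : Formula := .rel A.rel A.fst.toTerm A.snd.toTerm A.thd.toTerm

def Clause.toFormula (C : Clause) : Formula :=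
  C.body.foldr (fun A φ => A.toFormula.imp φ) C.head.toFormula

/-! ### Semantics of the derived formulas and arithmetic interpretations -/

section Sat

variable {𝒱 : Type*} {a : Assignment 𝒱} {ς : Computation} {t : ℕ} {φ ψ : Formula}

@[simp] theorem sat_neg : Sat a ς t (.neg φ) ↔ ¬ Sat a ς t φ := Iff.rfl

@[simp] theorem sat_and : Sat a ς t (.and φ ψ) ↔ Sat a ς t φ ∧ Sat a ς t ψ := Iff.rfl

@[simp] theorem sat_next : Sat a ς t (.next φ) ↔ Sat a ς (t + 1) φ := Iff.rfl

@[simp] theorem sat_update {s : ℕ} {τ : FTerm} : Sat a ς t (.update s τ) ↔ ς t s = τ := Iff.rfl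

@[simp] theorem sat_imp : Sat a ς t (φ.imp ψ) ↔ (Sat a ς t φ → Sat a ς t ψ) := by
  simp [Formula.imp]

@[simp] theorem sat_ev : Sat a ς t φ.ev ↔ ∃ t' ≥ t, Sat a ς t' φ := by
  simp [Formula.ev, Sat]

@[simp] theorem sat_alw : Sat a ς t φ.alw ↔ ∀ t' ≥ t, Sat a ς t' φ := by
  simp [Formula.alw]

@[simp] theorem sat_conj {l : List Formula} :
    Sat a ς t (.conj l) ↔ ∀ φ ∈ l, Sat a ς t φ := by
  induction l with
  | nil => simp [Formula.conj]
  | cons φ l ih => simp [Formula.conj, ih]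

theorem sat_rel {p : ℕ} {σ τ υ : FTerm} : Sat a ς t (.rel p σ τ υ) ↔
    a.pred 3 p ![value a ς t σ, value a ς t τ, value a ς t υ] = true := by
  have : (fun j => value a ς t (![σ, τ, υ] j)) =
      ![value a ς t σ, value a ς t τ, value a ς t υ] := by
    funext j
    fin_cases j <;> rfl
  simp only [Formula.rel, Sat, this]

theorem value_zero : value a ς t .zero = a.func 0 0 ![] := by
  simp only [value, FTerm.zero, FTerm.eval]
  congr 1
  exact Subsingleton.elim _ _

theorem value_succ (τ : FTerm) : value a ς t τ.succ = a.func 1 0 ![value a ς t τ] := by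
  simp only [value, FTerm.succ, FTerm.eval]
  congr 1
  funext j
  fin_cases j
  rfl

/-- The assignment interprets zero, successor and the ternary predicates in accordance with the
interpretation `I` over the natural numbers, where `r` relates values to natural numbers. -/
structure Interprets (a : Assignment 𝒱) (r : 𝒱 → ℕ → Prop) (I : ℕ → ℕ → ℕ → ℕ → Prop) :
    Prop where
  zero : r (a.func 0 0 ![]) 0
  succ : ∀ x n, r x n → r (a.func 1 0 ![x]) (n + 1)
  rel : ∀ p x y z l m n, r x l → r y m → r z n → (a.pred 3 p ![x, y, z] = true ↔ I p l m n)

namespace Interprets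

variable {r : 𝒱 → ℕ → Prop} {I : ℕ → ℕ → ℕ → ℕ → Prop}

theorem value_zero (h : Interprets a r I) : r (value a ς t .zero) 0 := by
  rw [TSL.value_zero]
  exact h.zero

theorem value_succ (h : Interprets a r I) {τ : FTerm} {n : ℕ} (hτ : r (value a ς t τ) n) :
    r (value a ς t τ.succ) (n + 1) := by
  rw [TSL.value_succ]
  exact h.succ _ _ hτ

theorem value_numeral (h : Interprets a r I) (n : ℕ) : r (value a ς t (.numeral n)) n := by
  induction n with
  | zero => exact h.value_zero
  | succ n ih => exact h.value_succ ih

theorem sat_rel (h : Interprets a r I) {p l m n : ℕ} {σ τ υ : FTerm} (hσ : r (value a ς t σ) l)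
    (hτ : r (value a ς t τ) m) (hυ : r (value a ς t υ) n) :
    Sat a ς t (.rel p σ τ υ) ↔ I p l m n := by
  rw [TSL.sat_rel]
  exact h.rel _ _ _ _ _ _ _ hσ hτ hυ

theorem sat_atom (h : Interprets a r I) {b : Fin 8 → ℕ}
    (hb : ∀ i : Fin 8, r (outVal a ς t i) (b i)) (A : Atom) :
    Sat a ς t A.toFormula ↔ A.Holds I b := by
  have key : ∀ x : Arg, r (value a ς t x.toTerm) (x.val b) := by
    rintro (_ | i | i)
    · exact h.value_zero
    · exact hb i
    · exact h.value_succ (hb i)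
  exact h.sat_rel (key _) (key _) (key _)

theorem sat_clause (h : Interprets a r I) {b : Fin 8 → ℕ}
    (hb : ∀ i : Fin 8, r (outVal a ς t i) (b i)) (C : Clause) :
    Sat a ς t C.toFormula ↔ C.Holds I b := by
  obtain ⟨l, A⟩ := C
  simp only [Clause.toFormula, Clause.Holds]
  induction l with
  | nil => exact h.sat_atom hb A
  | cons B l ih => simp [h.sat_atom hb B, ih]

end Interprets

/-- The value of the numeral of `n`. -/
def numVal (a : Assignment 𝒱) (n : ℕ) : 𝒱 := (fun x => a.func 1 0 ![x])^[n] (a.func 0 0 ![])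

theorem numVal_succ (a : Assignment 𝒱) (n : ℕ) :
    numVal a (n + 1) = a.func 1 0 ![numVal a n] :=
  Function.iterate_succ_apply' _ _ _

/-- The predicates of the assignment on numerals. -/
def numRel (a : Assignment 𝒱) (p l m n : ℕ) : Prop :=
  a.pred 3 p ![numVal a l, numVal a m, numVal a n] = true

/-- Numerals may share a value under an arbitrary assignment; this is why `Interprets` uses a
relation instead of a decoding function. -/
theorem interprets_numRel (a : Assignment 𝒱) :
    Interprets a (fun x n => x = numVal a n) (numRel a) where
  zero := rfl
  succ := by
    rintro _ n rfl
    exact (numVal_succ a n).symm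
  rel := by
    rintro p _ _ _ l m n rfl rfl rfl
    exact Iff.rfl

open Classical in
/-- The assignment in which the values stand for the natural numbers and the predicates are the
intended ones. -/
noncomputable def stdAssignment [Nonempty 𝒱] (inp : ℕ → ℕ → 𝒱) (e : ℕ → 𝒱) : Assignment 𝒱 where
  input := inp
  init _ := e 0
  func
    | 1, _, x => e (Function.invFun e (x 0) + 1)
    | _, _, _ => e 0
  pred
    | 3, p, x => decide (stdRel p (Function.invFun e (x 0)) (Function.invFun e (x 1))
        (Function.invFun e (x 2)))
    | _, _, _ => true

/-- Every value decodes to some number, even outside the range of `e`, so the clauses can be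
evaluated whatever the outputs hold. -/
theorem interprets_stdRel [Nonempty 𝒱] (inp : ℕ → ℕ → 𝒱) {e : ℕ → 𝒱}
    (he : Function.Injective e) :
    Interprets (stdAssignment inp e) (fun x n => Function.invFun e x = n) stdRel where
  zero := Function.leftInverse_invFun he 0
  succ := by
    rintro x _ rfl
    exact Function.leftInverse_invFun he _
  rel := by
    rintro p x y z _ _ _ rfl rfl rfl
    exact @decide_eq_true_iff _ (Classical.propDecidable _)

/-! ### The formulas of the reductions -/

/-- The clauses for the code `c`. -/
def clausesFormula (c : Code) : Formula :=
  .conj ((arithClauses ++ codeClauses c).map Clause.toFormula)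

/-- The value of output `0` is the result of the function with code `c` on `n`. -/
def resultFormula (c : Code) (n : ℕ) : Formula :=
  .rel (graphRel c) (.numeral n) (.output 0) .zero

theorem numRel_of_sat_clausesFormula {c : Code}
    (h : ∀ b : Fin 8 → ℕ, ∃ t ≥ 1, (∀ i : Fin 8, outVal a ς t i = numVal a (b i)) ∧
      Sat a ς t (clausesFormula c)) {n m : ℕ} (hm : m ∈ c.eval n) :
    numRel a (graphRel c) n m 0 := by
  have key : ∀ C ∈ arithClauses ++ codeClauses c, ∀ b, C.Holds (numRel a) b := by
    intro C hC b
    obtain ⟨t, -, hb, ht⟩ := h b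
    exact ((interprets_numRel a).sat_clause hb C).1
      (sat_conj.1 ht _ (List.mem_map_of_mem hC))
  rw [List.forall_mem_append] at key
  exact graph_of_clauses key.1 c key.2 hm

theorem sat_resultFormula {r : 𝒱 → ℕ → Prop} {I : ℕ → ℕ → ℕ → ℕ → Prop} (h : Interprets a r I)
    {c : Code} {n m : ℕ} (hm : r (outVal a ς t 0) m) :
    Sat a ς t (resultFormula c n) ↔ I (graphRel c) n m 0 :=
  h.sat_rel (h.value_numeral n) hm h.value_zero

theorem sat_clausesFormula_std [Nonempty 𝒱] (inp : ℕ → ℕ → 𝒱) {e : ℕ → 𝒱}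
    (he : Function.Injective e) (ς : Computation) (t : ℕ) (c : Code) :
    Sat (stdAssignment inp e) ς t (clausesFormula c) := by
  simp only [clausesFormula, sat_conj, List.forall_mem_map]
  intro C hC
  rw [(interprets_stdRel inp he).sat_clause (fun _ => rfl)]
  rcases List.mem_append.1 hC with hC | hC
  · exact arithClauses_sound C hC _
  · exact codeClauses_sound c C hC _

/-- The term by which the odometer in state `X` updates output `s`. -/
def odoTerm (X : ℕ → ℕ) (s : ℕ) : FTerm :=
  if ∀ j < s, X j = X 8 then (if s < 8 ∧ X s = X 8 then .zero else .succ (.output s))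
  else .output s

/-- The computation which sets all outputs to zero and then runs the odometer. -/
def odoComputation : Computation
  | 0, _ => .zero
  | t + 1, s => odoTerm (odo 8 t) s

theorem value_odoTerm {X : ℕ → ℕ} {s : ℕ} (h : outVal a ς t s = numVal a (X s)) :
    value a ς t (odoTerm X s) = numVal a (odoStep 8 X s) := by
  unfold odoTerm odoStep
  split_ifs
  · exact (interprets_numRel a).value_zero
  · exact (interprets_numRel a).value_succ h
  · exact h

/-- Time 0 is spent overwriting the arbitrary initial values, hence the shift by one. The horizon
`T` allows use inside an induction where agreement is known only so far. -/
theorem outVal_eq_odo {T : ℕ} (h : ∀ t ≤ T, ∀ s ≤ 8, ς t s = odoComputation t s) :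
    ∀ t ≤ T, ∀ s ≤ 8, outVal a ς (t + 1) s = numVal a (odo 8 t s) := by
  intro t ht s hs
  change value a ς t (ς t s) = _
  induction t with
  | zero =>
    rw [h 0 ht s hs]
    exact (interprets_numRel a).value_zero
  | succ t ih =>
    rw [h (t + 1) ht s hs, odo_succ]
    exact value_odoTerm (ih (by omega))

/-- The digit at position `j` is equal to the bound of the odometer. -/
def eqBound (j : ℕ) : Formula := .rel 0 (.output j) (.output 8) .zero

/-- The digits below position `s` are equal to the bound of the odometer. -/
def carry (s : ℕ) : Formula := .conj ((List.range s).map eqBound)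

/-- The updates of the digit at position `s`. -/
def digitMove (s : ℕ) : Formula :=
  .and ((carry s).imp (.and ((eqBound s).imp (.update s .zero))
      ((eqBound s).neg.imp (.update s (.succ (.output s))))))
    ((carry s).neg.imp (.update s (.output s)))

/-- The updates of the odometer. -/
def odoMove : Formula :=
  .and (.conj ((List.range 8).map digitMove))
    (.and ((carry 8).imp (.update 8 (.succ (.output 8))))
      ((carry 8).neg.imp (.update 8 (.output 8))))

/-- Only the current comparisons of digits with the bound matter, so predicate 0 need not be
equality everywhere. -/
theorem sat_odoMove {X : ℕ → ℕ} (h : ∀ j < 8, (Sat a ς t (eqBound j) ↔ X j = X 8)) :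
    Sat a ς t odoMove ↔ ∀ s ≤ 8, ς t s = odoTerm X s := by
  have hc : ∀ s ≤ 8, (Sat a ς t (carry s) ↔ ∀ j < s, X j = X 8) := by
    intro s hs
    simp only [carry, sat_conj, List.forall_mem_map, List.mem_range]
    exact forall₂_congr fun j hj => h j (by omega)
  have hd : ∀ s < 8, (Sat a ς t (digitMove s) ↔ ς t s = odoTerm X s) := by
    intro s hs
    simp only [digitMove, sat_and, sat_imp, sat_neg, sat_update, hc s hs.le, h s hs, odoTerm, hs,
      true_and]
    split_ifs <;> simp_all
  have h8 : Sat a ς t (.and ((carry 8).imp (.update 8 (.succ (.output 8))))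
      ((carry 8).neg.imp (.update 8 (.output 8)))) ↔ ς t 8 = odoTerm X 8 := by
    simp only [sat_and, sat_imp, sat_neg, sat_update, hc 8 le_rfl, odoTerm, lt_irrefl, false_and,
      if_false]
    split_ifs <;> simp_all
  rw [odoMove, sat_and, h8, sat_conj, List.forall_mem_map]
  simp only [List.mem_range]
  rw [forall₂_congr hd]
  constructor
  · rintro ⟨h1, h2⟩ s hs
    rcases hs.lt_or_eq with hs | rfl
    · exact h1 s hs
    · exact h2
  · exact fun h => ⟨fun s hs => h s hs.le, h 8 le_rfl⟩

/-- Axioms of equality between a digit and the bound of the odometer. -/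
def eqAxioms : Formula :=
  .and (.rel 0 .zero .zero .zero)
    (.and (.neg (.rel 0 .zero (.succ (.output 8)) .zero))
      (.and ((eqBound 0).imp (.rel 0 (.succ (.output 0)) (.succ (.output 8)) .zero))
        (.imp (.rel 0 (.succ (.output 0)) (.succ (.output 8)) .zero) (eqBound 0))))

theorem sat_eqAxioms {r : 𝒱 → ℕ → Prop} {I : ℕ → ℕ → ℕ → ℕ → Prop} (h : Interprets a r I)
    {x y : ℕ} (hx : r (outVal a ς t 0) x) (hy : r (outVal a ς t 8) y) :
    Sat a ς t eqAxioms ↔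
      I 0 0 0 0 ∧ ¬ I 0 0 (y + 1) 0 ∧ (I 0 (x + 1) (y + 1) 0 ↔ I 0 x y 0) := by
  have h0 : r (value a ς t .zero) 0 := h.value_zero
  have hsx : r (value a ς t (.succ (.output 0))) (x + 1) := h.value_succ hx
  have hsy : r (value a ς t (.succ (.output 8))) (y + 1) := h.value_succ hy
  simp only [eqAxioms, eqBound, sat_and, sat_neg, sat_imp, h.sat_rel h0 h0 h0,
    h.sat_rel h0 hsy h0, h.sat_rel hsx hsy h0,
    h.sat_rel (σ := .output 0) (τ := .output 8) hx hy h0]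
  tauto

/-- A formula which is realizable if and only if the computation of `c` on `n` terminates. -/
def haltFormula (c : Code) (n : ℕ) : Formula :=
  .next ((clausesFormula c).alw.imp (resultFormula c n).ev)

/-- A formula which is satisfiable if and only if the computation of `c` on `n` diverges. -/
def divergeFormula (c : Code) (n : ℕ) : Formula :=
  .and (.conj ((List.range 9).map fun s => .update s .zero))
    (.next (Formula.alw (.and (.and (clausesFormula c) (.and eqAxioms odoMove))
      (resultFormula c n).neg)))

end Sat

theorem exists_odo_eq (b : Fin 8 → ℕ) (y : ℕ) (hb : ∀ i, b i ≤ y) :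
    ∃ t, (∀ i : Fin 8, odo 8 t i = b i) ∧ odo 8 t 8 = y := by
  obtain ⟨t, ht, hy⟩ := odo_visits 8 y (fun j => if h : j < 8 then b ⟨j, h⟩ else 0)
    (fun j hj => by simpa [hj] using hb _)
  exact ⟨t, fun i => by simpa using ht i i.2, hy⟩

theorem odo_le_bound (k t : ℕ) : ∀ j < k, odo k t j ≤ odo k t k := by
  induction t with
  | zero => simp [odo]
  | succ t ih =>
    intro j hj
    refine le_trans ?_ (odo_bound_mono k (Nat.le_succ t))
    have := ih j hj
    simp only [odo_succ, odoStep]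
    split_ifs <;> omega

/-! ### Correctness of the reductions -/

section Correct

variable {𝒱 : Type*} {c : Code} {n : ℕ}

/-- The odometer visits every tuple, so the clauses hold for all numerals and the graph predicate
contains the true result `m`; output 0 equals the numeral of `m` at some time. -/
theorem exists_sat_resultFormula {a : Assignment 𝒱} {ς : Computation}
    (hς : ∀ t, ∀ s ≤ 8, ς t s = odoComputation t s)
    (h : ∀ t ≥ 1, Sat a ς t (clausesFormula c)) (hn : (c.eval n).Dom) :
    ∃ t ≥ 1, Sat a ς t (resultFormula c n) := by
  have hout : ∀ t, ∀ s ≤ 8, outVal a ς (t + 1) s = numVal a (odo 8 t s) := fun t =>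
    outVal_eq_odo (fun t _ => hς t) t le_rfl
  have hvisit : ∀ b : Fin 8 → ℕ, ∃ t ≥ 1, ∀ i : Fin 8, outVal a ς t i = numVal a (b i) := by
    intro b
    -- The sum is just a convenient common upper bound for the digits.
    obtain ⟨t, ht, -⟩ := exists_odo_eq b (∑ i, b i) fun i =>
      Finset.single_le_sum (fun _ _ => Nat.zero_le _) (Finset.mem_univ i)
    exact ⟨t + 1, by omega, fun i => by rw [hout t i (by omega), ht]⟩
  obtain ⟨m, hm⟩ := Part.dom_iff_mem.1 hn
  obtain ⟨t, ht, hb⟩ := hvisit fun _ => m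
  refine ⟨t, ht, (sat_resultFormula (interprets_numRel a) (hb 0)).2 ?_⟩
  refine numRel_of_sat_clausesFormula (ς := ς) (fun b => ?_) hm
  obtain ⟨t, ht, hb⟩ := hvisit b
  exact ⟨t, ht, hb, h t ht⟩

/-- Each output is updated using only itself, zero and successor. -/
theorem odoComputation_over {N : Vocabulary} (h0 : (0, 0) ∈ N.funcs) (h1 : (1, 0) ∈ N.funcs) :
    odoComputation.Over N := by
  have hz : FTerm.zero.Over N := ⟨h0, fun j => j.elim0⟩
  rintro (_ | t) s hs
  · exact hz
  · simp only [odoComputation, odoTerm]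
    split_ifs
    · exact hz
    · exact ⟨h1, fun j => by fin_cases j; exact hs⟩
    · exact hs

theorem realizable_haltFormula {N : Vocabulary} (h0 : (0, 0) ∈ N.funcs) (h1 : (1, 0) ∈ N.funcs)
    (hn : (c.eval n).Dom) : Realizable 𝒱 N (haltFormula c n) := by
  refine ⟨odoComputation, odoComputation_over h0 h1, fun a => ?_⟩
  simp only [haltFormula, sat_next, sat_imp, sat_alw, sat_ev]
  exact fun h => exists_sat_resultFormula (fun _ _ _ => rfl) h hn

theorem Realizable.uniformlySatisfiable [Nonempty 𝒱] {N : Vocabulary} {φ : Formula}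
    (h : Realizable 𝒱 N φ) : UniformlySatisfiable 𝒱 N φ := by
  obtain ⟨ς, hς, h⟩ := h
  exact ⟨ς, hς, fun _ _ => Classical.arbitrary 𝒱, fun a _ => h a⟩

theorem dom_of_uniformlySatisfiable [Infinite 𝒱] {N : Vocabulary}
    (h : UniformlySatisfiable 𝒱 N (haltFormula c n)) : (c.eval n).Dom := by
  obtain ⟨ς, -, inp, h⟩ := h
  have he := (Infinite.natEmbedding 𝒱).injective
  have h := h (stdAssignment inp (Infinite.natEmbedding 𝒱)) rfl
  simp only [haltFormula, sat_next, sat_imp, sat_alw, sat_ev] at h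
  obtain ⟨t, -, ht⟩ := h fun t _ => sat_clausesFormula_std inp he ς t c
  rw [sat_resultFormula (interprets_stdRel inp he) rfl, stdRel_graphRel] at ht
  exact Part.dom_iff_mem.2 ⟨_, ht⟩

theorem satisfiable_divergeFormula [Infinite 𝒱] {N : Vocabulary} (h0 : (0, 0) ∈ N.funcs)
    (h1 : (1, 0) ∈ N.funcs) (hn : ¬ (c.eval n).Dom) :
    Satisfiable 𝒱 N (divergeFormula c n) := by
  have he := (Infinite.natEmbedding 𝒱).injective
  set e := Infinite.natEmbedding 𝒱
  set inp : ℕ → ℕ → 𝒱 := fun _ _ => e 0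
  refine ⟨odoComputation, odoComputation_over h0 h1, stdAssignment inp e, ?_⟩
  have hi := interprets_stdRel inp he
  have hval : ∀ n, Function.invFun e (numVal (stdAssignment inp e) n) = n := by
    intro n
    induction n with
    | zero => exact hi.zero
    | succ n ih =>
      rw [numVal_succ]
      exact hi.succ _ _ ih
  have hout : ∀ t, ∀ s ≤ 8,
      Function.invFun e (outVal (stdAssignment inp e) odoComputation (t + 1) s) = odo 8 t s := by
    intro t s hs
    rw [outVal_eq_odo (fun _ _ _ _ => rfl) t le_rfl s hs, hval]
  simp only [divergeFormula, sat_and, sat_conj, List.forall_mem_map, sat_update, sat_next, sat_alw,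
    sat_neg]
  refine ⟨fun _ _ => rfl, fun t ht => ?_⟩
  obtain ⟨t, rfl⟩ := Nat.exists_eq_add_of_le' ht
  refine ⟨⟨sat_clausesFormula_std inp he _ _ c, ?_, ?_⟩, ?_⟩
  · rw [sat_eqAxioms hi rfl rfl]
    simp [stdRel]
  · rw [sat_odoMove (X := odo 8 t)]
    · exact fun _ _ => rfl
    · exact fun j hj => hi.sat_rel (hout t j hj.le) (hout t 8 le_rfl) hi.value_zero
  · rw [sat_resultFormula hi rfl, stdRel_graphRel]
    exact fun h => hn (Part.dom_iff_mem.2 ⟨_, h⟩)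

/-- By strong induction on time the computation must be the odometer: its past run has already
collected the equality axioms needed to decide the next move. -/
theorem not_dom_of_satisfiable {N : Vocabulary} (h : Satisfiable 𝒱 N (divergeFormula c n)) :
    ¬ (c.eval n).Dom := by
  obtain ⟨ς, -, a, h⟩ := h
  simp only [divergeFormula, sat_and, sat_conj, List.forall_mem_map, sat_update, sat_next, sat_alw,
    sat_neg, List.mem_range, zero_add] at h
  obtain ⟨hz, h⟩ := h
  have hi := interprets_numRel a
  have hς : ∀ t, ∀ s ≤ 8, ς t s = odoComputation t s := by
    intro t
    induction t using Nat.strong_induction_on with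
    | _ t ih =>
    cases t with
    | zero => exact fun s hs => hz s (by omega)
    | succ T =>
      have hout := outVal_eq_odo (a := a) (T := T) fun t ht => ih t (by omega)
      have hax : ∀ t ≤ T, _ := fun t ht => (sat_eqAxioms hi (hout t ht 0 (by omega))
        (hout t ht 8 le_rfl)).1 (h (t + 1) (by omega)).1.2.1
      -- Predicate 0 is equality for all numbers up to the current bound. Pairs with `x ≤ y` suffice
      -- because digits never exceed the bound.
      have hD : ∀ y ≤ odo 8 T 8, ∀ x ≤ y, (numRel a 0 x y 0 ↔ x = y) := by
        intro y
        induction y with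
        | zero =>
          intro _ x hx
          obtain rfl : x = 0 := by omega
          simpa using (hax 0 (by omega)).1
        | succ y ihy =>
          intro hy x hx
          -- The axioms relate bound `y` to `y + 1`, so a time with bound `y` is needed; it lies in
          -- the past because the bound is monotone. Truncated subtraction also covers `x = 0`,
          -- where any such time will do.
          obtain ⟨t, ht, hty⟩ := exists_odo_eq (fun _ => x - 1) y (fun _ => by omega)
          have htT : t ≤ T := by
            by_contra hlt
            have : odo 8 T 8 ≤ odo 8 t 8 := odo_bound_mono 8 (by omega)
            omega
          obtain ⟨-, h1, h2⟩ := hax t htT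
          rw [hty] at h1 h2
          rw [show odo 8 t 0 = x - 1 from ht 0] at h2
          cases x with
          | zero => simpa using h1
          | succ x =>
            rw [Nat.add_sub_cancel] at h2
            rw [h2, ihy (by omega) x (by omega)]
            omega
      refine (sat_odoMove (a := a) (X := odo 8 T) fun j hj => ?_).1 (h (T + 1) (by omega)).1.2.2
      rw [← hD _ le_rfl _ (odo_le_bound 8 T j hj)]
      exact hi.sat_rel (hout T le_rfl j hj.le) (hout T le_rfl 8 le_rfl) hi.value_zero
  intro hn
  obtain ⟨t, ht, hr⟩ := exists_sat_resultFormula hς (fun t ht => (h t ht).1.1) hn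
  exact (h t ht).2 hr

end Correct

/-! ### Names that occur in the formulas -/

section Over

variable {N : Vocabulary}

@[simp] theorem over_zero : FTerm.zero.Over N ↔ (0, 0) ∈ N.funcs := by
  simp [FTerm.zero, FTerm.Over]

@[simp] theorem over_succ {τ : FTerm} : τ.succ.Over N ↔ (1, 0) ∈ N.funcs ∧ τ.Over N := by
  simp [FTerm.succ, FTerm.Over]

@[simp] theorem over_rel {p : ℕ} {σ τ υ : FTerm} : (Formula.rel p σ τ υ).Over N ↔
    (3, p) ∈ N.preds ∧ σ.Over N ∧ τ.Over N ∧ υ.Over N := by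
  simp [Formula.rel, Formula.Over, Fin.forall_fin_succ]

@[simp] theorem over_imp {φ ψ : Formula} : (φ.imp ψ).Over N ↔ φ.Over N ∧ ψ.Over N := Iff.rfl

@[simp] theorem over_ev {φ : Formula} : φ.ev.Over N ↔ φ.Over N := by
  simp [Formula.ev, Formula.Over]

@[simp] theorem over_alw {φ : Formula} : φ.alw.Over N ↔ φ.Over N := over_ev

theorem over_of_mem_conj {l : List Formula} (h : (Formula.conj l).Over N) :
    ∀ φ ∈ l, φ.Over N := by
  induction l with
  | nil => simp
  | cons φ l ih => exact List.forall_mem_cons.2 ⟨h.1, ih h.2⟩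

/-- Zero and successor occur in the two addition clauses, so every admissible vocabulary allows the
odometer computation. -/
theorem funcs_of_over_clausesFormula {c : Code} (h : (clausesFormula c).Over N) :
    (0, 0) ∈ N.funcs ∧ (1, 0) ∈ N.funcs := by
  have key := over_of_mem_conj h
  simp only [arithClauses, List.map_append, List.map_cons, List.forall_mem_append,
    List.forall_mem_cons] at key
  have h0 := key.1.1
  have h1 := key.1.2.1
  simp only [Clause.toFormula, List.foldr, Atom.toFormula, Arg.toTerm, over_imp, over_rel,
    over_zero, over_succ] at h0 h1
  tauto

theorem inputFree_haltFormula (c : Code) (n : ℕ) : (haltFormula c n).InputFree := by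
  have hterm : ∀ x : Arg, x.toTerm.Over ⟨∅, Set.univ, Set.univ, Set.univ⟩ := by
    rintro (_ | i | i) <;> simp [Arg.toTerm, FTerm.Over]
  have hclause : ∀ C : Clause, C.toFormula.Over ⟨∅, Set.univ, Set.univ, Set.univ⟩ := by
    rintro ⟨l, A⟩
    induction l with
    | nil => simp [Clause.toFormula, Atom.toFormula, hterm]
    | cons B l ih => exact ⟨by simp [Atom.toFormula, hterm], ih⟩
  have hconj : ∀ l : List Clause,
      (Formula.conj (l.map Clause.toFormula)).Over ⟨∅, Set.univ, Set.univ, Set.univ⟩ := by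
    intro l
    induction l with
    | nil => simp [Formula.conj, Formula.Over]
    | cons C l ih => exact ⟨hclause C, ih⟩
  have hnum : (FTerm.numeral n).Over ⟨∅, Set.univ, Set.univ, Set.univ⟩ := by
    induction n with
    | zero => simp [FTerm.numeral]
    | succ n ih => simp [FTerm.numeral, ih]
  simp [Formula.InputFree, haltFormula, Formula.Over, clausesFormula, -List.map_append, hconj,
    resultFormula, hnum, FTerm.Over]

end Over

/-! ### Computability of the reductions -/

theorem code_succ (τ : FTerm) :
    τ.succ.code = Nat.pair 3 (Nat.pair 1 (Nat.pair 0 (Encodable.encode [τ.code]))) := by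
  simp [FTerm.succ, FTerm.code]

theorem primrec_code_numeral : Primrec fun n => (FTerm.numeral n).code := by
  have hstep : Primrec₂ fun (_ : ℕ) (x : ℕ) =>
      Nat.pair 3 (Nat.pair 1 (Nat.pair 0 (Encodable.encode [x]))) := by
    refine Primrec₂.natPair.comp₂ (.const 3) (Primrec₂.natPair.comp₂ (.const 1)
      (Primrec₂.natPair.comp₂ (.const 0) ?_))
    exact Primrec.encode.comp (Primrec.list_cons.comp Primrec.snd (Primrec.const []))
  refine (Primrec.nat_rec₁ FTerm.zero.code hstep).of_eq fun n => ?_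
  induction n with
  | zero => rfl
  | succ n ih => simp only [FTerm.numeral, code_succ, ← ih]

theorem primrec_code_resultFormula (c : Code) : Primrec fun n => (resultFormula c n).code := by
  have : ∀ n, (resultFormula c n).code = Nat.pair 0 (Nat.pair 3 (Nat.pair (graphRel c)
      (Encodable.encode [(FTerm.numeral n).code, (FTerm.output 0).code, FTerm.zero.code]))) := by
    intro n
    simp [resultFormula, Formula.rel, Formula.code]
  simp only [this]
  exact Primrec₂.natPair.comp (.const 0) (Primrec₂.natPair.comp (.const 3)
    (Primrec₂.natPair.comp (.const _) (Primrec.encode.comp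
      (Primrec.list_cons.comp primrec_code_numeral (.const _)))))

section

variable {f g : ℕ → Formula}

theorem primrec_code_neg (hf : Primrec fun n => (f n).code) :
    Primrec fun n => (f n).neg.code :=
  Primrec₂.natPair.comp (.const 2) hf

theorem primrec_code_and (hf : Primrec fun n => (f n).code) (hg : Primrec fun n => (g n).code) :
    Primrec fun n => ((f n).and (g n)).code :=
  Primrec₂.natPair.comp (.const 3) (Primrec₂.natPair.comp hf hg)

theorem primrec_code_next (hf : Primrec fun n => (f n).code) :
    Primrec fun n => (f n).next.code :=
  Primrec₂.natPair.comp (.const 4) hf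

theorem primrec_code_imp (hf : Primrec fun n => (f n).code) (hg : Primrec fun n => (g n).code) :
    Primrec fun n => ((f n).imp (g n)).code :=
  primrec_code_neg (primrec_code_and hf (primrec_code_neg hg))

theorem primrec_code_ev (hf : Primrec fun n => (f n).code) :
    Primrec fun n => (f n).ev.code :=
  Primrec₂.natPair.comp (.const 5) (Primrec₂.natPair.comp (primrec_code_imp hf hf) hf)

theorem primrec_code_haltFormula (c : Code) : Primrec fun n => (haltFormula c n).code :=
  primrec_code_next (primrec_code_imp (.const _) (primrec_code_ev (primrec_code_resultFormula c)))

theorem primrec_code_divergeFormula (c : Code) : Primrec fun n => (divergeFormula c n).code :=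
  primrec_code_and (.const _) (primrec_code_next (primrec_code_neg (primrec_code_ev
    (primrec_code_neg (primrec_code_and (.const _)
      (primrec_code_neg (primrec_code_resultFormula c)))))))

end

/-- Some partial recursive function has an undecidable domain. -/
theorem exists_code_undecidable_dom :
    ∃ c : Code, ¬ ComputablePred fun n => (c.eval n).Dom := by
  -- The domain of this universal function is the halting set. Fixing one code keeps the clauses
  -- constant, so only the numeral of `n` varies in the reduction.
  have hpart : Partrec fun n : ℕ => (Denumerable.ofNat Code n).eval 0 :=
    Code.eval_part.comp (Computable.ofNat Code) (Computable.const 0)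
  obtain ⟨c, hc⟩ := Code.exists_code.1 (Partrec.nat_iff.1 hpart)
  refine ⟨c, fun h => ComputablePred.halting_problem 0 ?_⟩
  rw [hc] at h
  obtain ⟨f, hf, hfp⟩ := ComputablePred.computable_iff.1 h
  refine ComputablePred.computable_iff.2 ⟨_, hf.comp Computable.encode, ?_⟩
  funext d
  simpa using congrFun hfp (Encodable.encode d)

theorem not_decidableOn_of_reduction {C P : Formula → Prop} {p : ℕ → Prop}
    (hp : ¬ ComputablePred p) {f : ℕ → Formula} (hf : Primrec fun n => (f n).code)
    (hC : ∀ n, C (f n)) (h : ∀ n, P (f n) ↔ p n) : ¬ DecidableOn C P := by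
  rintro ⟨d, hd, hdP⟩
  refine hp (ComputablePred.computable_iff.2 ⟨_, hd.comp hf.to_comp, ?_⟩)
  funext n
  exact propext ((hdP _ (hC n)).trans (h n)).symm

end TSL

theorem theorem3 {𝒱 : Type*} [Infinite 𝒱] (N : TSL.Formula → TSL.Vocabulary)
    (hN : ∀ φ : TSL.Formula, φ.Over (N φ)) :
    TSL.Undecidable (fun φ => TSL.Realizable 𝒱 (N φ) φ) ∧
    ¬ TSL.DecidableOn TSL.Formula.InputFree (fun φ => TSL.Realizable 𝒱 (N φ) φ) ∧
    TSL.Undecidable (fun φ => TSL.Satisfiable 𝒱 (N φ) φ) ∧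
    TSL.Undecidable (fun φ => TSL.UniformlySatisfiable 𝒱 (N φ) φ) := by
  open TSL in
  obtain ⟨c, hc⟩ := exists_code_undecidable_dom
  have hcompl : ¬ ComputablePred fun n => ¬ (c.eval n).Dom := fun h =>
    hc (h.not.of_eq fun n => not_not)
  have hhalt := fun n => by
    have := hN (haltFormula c n)
    simp only [haltFormula, Formula.Over, over_imp, over_alw] at this
    exact funcs_of_over_clausesFormula this.1
  have hdiv := fun n => by
    have := (hN (divergeFormula c n)).2
    simp only [Formula.Over, over_alw] at this
    exact funcs_of_over_clausesFormula this.1.1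
  have hreal : ∀ n, Realizable 𝒱 (N (haltFormula c n)) (haltFormula c n) ↔ (c.eval n).Dom :=
    fun n => ⟨fun h => dom_of_uniformlySatisfiable h.uniformlySatisfiable,
      realizable_haltFormula (hhalt n).1 (hhalt n).2⟩
  refine ⟨?_, ?_, ?_, ?_⟩
  · exact not_decidableOn_of_reduction hc (primrec_code_haltFormula c) (fun _ => trivial) hreal
  · exact not_decidableOn_of_reduction hc (primrec_code_haltFormula c) (inputFree_haltFormula c)
      hreal
  · exact not_decidableOn_of_reduction hcompl (primrec_code_divergeFormula c) (fun _ => trivial)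
      fun n => ⟨not_dom_of_satisfiable, satisfiable_divergeFormula (hdiv n).1 (hdiv n).2⟩
  · exact not_decidableOn_of_reduction hc (primrec_code_haltFormula c) (fun _ => trivial)
      fun n => ⟨dom_of_uniformlySatisfiable, fun h =>
        (realizable_haltFormula (hhalt n).1 (hhalt n).2 h).uniformlySatisfiable⟩
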